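/- Let $d\ge 1$ and $N\ge 1$ be integers. A scheme for deterministic port-based teleportation (PBT) with input dimension $d$ and $N$ ports consists of a finite-dimensional system $A$ of Alice, ports $B_1,\dots,B_N$ with $\mathcal H_{B_i}\cong\mathbb C^d$, a quantum state $\rho_{AB_1\cdots B_N}$ (the resource), and a POVM $\{E_i\}_{i=1}^N$ on $A_0A$, where $\mathcal H_{A_0}\cong\mathbb C^d$ is the input system. It implements the channel $$\Lambda(X)=\sum_{i=1}^N \mathrm{id}_{B_i\to B_0}\,\mathrm{tr}_{A_0AB_i^c}\bigl[(E_i\otimes I_{B_1\cdots B_N})(X_{A_0}\otimes\rho_{AB_1\cdots B_N})\bigr],$$ where $B_i^c$ denotes all ports except $B_i$. Its entanglement fidelity is $F(\Lambda)=F\bigl((\mathrm{id}\otimes\Lambda)(\phi^+),\phi^+\bigr)$, where $F(\rho,\sigma)=\|\sqrt\rho\sqrt\sigma\|_1^2$ and $\phi^+$ is the maximally entangled state on $\mathbb C^d\otimes\mathbb C^d$; its diamond norm error is $\|\mathrm{id}-\Lambda\|_\diamond$, where $\|\Lambda\|_\diamond=\sup_{\|X_{A'A_0}\|_1\le 1}\|(\mathrm{id}_{A'}\otimes\Lambda)(X)\|_1$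 with $A'\cong A_0$. Let $F_d^*(N)$ be the supremum of the entanglement fidelity and $\varepsilon_d^*(N)$ the infimum of the diamond norm error over all such schemes. Then $$F_d^*(N)\le\begin{cases}\dfrac{\sqrt N}{d}&\text{if }N\le \dfrac{d^2}{2},\\[2mm] 1-\dfrac{d^2-1}{16N^2}&\text{otherwise,}\end{cases}\qquad \varepsilon_d^*(N)\ge\begin{cases}2\Bigl(1-\dfrac{\sqrt N}{d}\Bigr)&\text{if }N\le \dfrac{d^2}{2},\\[2mm] 2\,\dfrac{d^2-1}{16N^2}&\text{otherwise.}\end{cases}$$ In particular, every individual scheme has entanglement fidelity and diamond norm error satisfying these bounds. -/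

import Mathlib

namespace PortTeleport

noncomputable section

open scoped Kronecker ComplexOrder MatrixOrder

/-! Operators on a finite-dimensional Hilbert space with orthonormal basis indexed by `ι` are
written as complex matrices `Matrix ι ι ℂ`; a tensor product of systems has the product index
type, and an `N`-fold tensor power of `ℂ^d` has the index type `Fin N → Fin d`. -/

/-- The trace norm `‖X‖₁ = tr √(X† X)`. -/
def traceNorm {ι : Type*} [Fintype ι] [DecidableEq ι] (X : Matrix ι ι ℂ) : ℝ :=
  (CFC.sqrt (X.conjTranspose * X)).trace.re

/-- The fidelity `F(ρ, σ) = ‖√ρ √σ‖₁²` of two states (the squared convention). -/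
def fidelity {ι : Type*} [Fintype ι] [DecidableEq ι] (ρ σ : Matrix ι ι ℂ) : ℝ :=
  traceNorm (CFC.sqrt ρ * CFC.sqrt σ) ^ 2

/-- A quantum state: a positive semidefinite operator of unit trace. -/
def IsState {ι : Type*} [Fintype ι] (ρ : Matrix ι ι ℂ) : Prop :=
  ρ.PosSemidef ∧ ρ.trace = 1

/-- A positive operator-valued measure with outcomes `κ`. -/
def IsPOVM {ι κ : Type*} [Fintype κ] [DecidableEq ι] (E : κ → Matrix ι ι ℂ) : Prop :=
  (∀ k, (E k).PosSemidef) ∧ ∑ k, E k = 1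

/-- The partial trace over the first tensor factor. -/
def traceFst {ι κ : Type*} [Fintype ι] (M : Matrix (ι × κ) (ι × κ) ℂ) : Matrix κ κ ℂ :=
  Matrix.of fun k l => ∑ a, M (a, k) (a, l)

/-- The partial trace over the second tensor factor. -/
def traceSnd {ι κ : Type*} [Fintype κ] (M : Matrix (ι × κ) (ι × κ) ℂ) : Matrix ι ι ℂ :=
  Matrix.of fun a b => ∑ k, M (a, k) (b, k)

/-- The operator on `ℂ^d` obtained from an operator on `B₁ ⋯ B_N` by tracing out every `B_j`
with `j ≠ i`, where the remaining system `B_i` is renamed to the output system `B₀`. -/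
def selectPort {d N : ℕ} (i : Fin N) (M : Matrix (Fin N → Fin d) (Fin N → Fin d) ℂ) :
    Matrix (Fin d) (Fin d) ℂ :=
  traceSnd (Matrix.reindex (Equiv.funSplitAt i (Fin d)) (Equiv.funSplitAt i (Fin d)) M)

/-- The map `id_{A'} ⊗ Λ`, with the reference system `A'` indexed by `κ`. -/
def idTensor {ι ι' : Type*} (κ : Type*) (Λ : Matrix ι ι ℂ →ₗ[ℂ] Matrix ι' ι' ℂ)
    (X : Matrix (κ × ι) (κ × ι) ℂ) : Matrix (κ × ι') (κ × ι') ℂ :=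
  Matrix.of fun p q => Λ (Matrix.of fun a b => X (p.1, a) (q.1, b)) p.2 q.2

/-- The unit vector `|φ⁺⟩ = d^{-1/2} ∑ᵢ |i⟩|i⟩`. -/
def phiVec (d : ℕ) : Fin d × Fin d → ℂ :=
  fun p => if p.1 = p.2 then ((1 / √(d : ℝ) : ℝ) : ℂ) else 0

/-- The maximally entangled state `|φ⁺⟩⟨φ⁺|`. -/
def phiState (d : ℕ) : Matrix (Fin d × Fin d) (Fin d × Fin d) ℂ :=
  Matrix.vecMulVec (phiVec d) (star (phiVec d))

/-- The entanglement fidelity `F(Λ₁, Λ₂)`. -/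
def entanglementFidelity {d : ℕ}
    (Λ₁ Λ₂ : Matrix (Fin d) (Fin d) ℂ →ₗ[ℂ] Matrix (Fin d) (Fin d) ℂ) : ℝ :=
  fidelity (idTensor (Fin d) Λ₁ (phiState d)) (idTensor (Fin d) Λ₂ (phiState d))

/-- The diamond norm `‖Λ‖_⋄ = sup {‖(id_{A'} ⊗ Λ)(X)‖₁ : ‖X‖₁ ≤ 1}`, with `A'` a copy of the
input system `A`. -/
def diamondNorm {ι ι' : Type*} [Fintype ι] [DecidableEq ι] [Fintype ι'] [DecidableEq ι']
    (Λ : Matrix ι ι ℂ →ₗ[ℂ] Matrix ι' ι' ℂ) : ℝ :=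
  sSup {r : ℝ | ∃ X : Matrix (ι × ι) (ι × ι) ℂ,
    traceNorm X ≤ 1 ∧ r = traceNorm (idTensor ι Λ X)}

/-- A scheme for deterministic port-based teleportation with input dimension `d` and `N` ports.
Alice's part `A` of the resource may have any finite dimension (for instance `d ^ N`); Bob's part
consists of the `N` ports `B₁, …, B_N` of dimension `d`. -/
structure Scheme (d N : ℕ) where
  /-- The dimension of Alice's part of the resource. -/
  m : ℕ
  /-- The resource state `ρ_{A B₁ ⋯ B_N}`. -/
  resource : Matrix (Fin m × (Fin N → Fin d)) (Fin m × (Fin N → Fin d)) ℂ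
  /-- Alice's measurement on the input `A₀` and on `A`. -/
  povm : Fin N → Matrix (Fin d × Fin m) (Fin d × Fin m) ℂ
  isState_resource : IsState resource
  isPOVM_povm : IsPOVM povm

/-- The unnormalized state of Bob's ports when Alice's outcome is `i` on the input `X`:
`tr_{A₀A} [(E_i ⊗ 1_{B₁⋯B_N}) (X ⊗ ρ)]`. -/
def Scheme.postMeasurement {d N : ℕ} (P : Scheme d N) (i : Fin N)
    (X : Matrix (Fin d) (Fin d) ℂ) : Matrix (Fin N → Fin d) (Fin N → Fin d) ℂ :=
  traceFst ((P.povm i ⊗ₖ (1 : Matrix (Fin N → Fin d) (Fin N → Fin d) ℂ)) *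
    Matrix.reindex (Equiv.prodAssoc _ _ _).symm (Equiv.prodAssoc _ _ _).symm (X ⊗ₖ P.resource))

/-- The channel from `A₀` to `B₀` implemented by the scheme:
`Λ(X) = ∑ᵢ id_{B_i → B₀} tr_{A₀ A B_i^c} [(E_i ⊗ 1) (X ⊗ ρ)]`. -/
def Scheme.channel {d N : ℕ} (P : Scheme d N) :
    Matrix (Fin d) (Fin d) ℂ →ₗ[ℂ] Matrix (Fin d) (Fin d) ℂ where
  toFun X := ∑ i, selectPort i (P.postMeasurement i X)
  map_add' X Y := by
    rw [← Finset.sum_add_distrib]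
    refine Finset.sum_congr rfl fun i _ => ?_
    ext k l
    simp [selectPort, Scheme.postMeasurement, traceSnd, traceFst, Matrix.mul_apply, add_mul,
      mul_add, Finset.sum_add_distrib]
  map_smul' c X := by
    rw [RingHom.id_apply, Finset.smul_sum]
    refine Finset.sum_congr rfl fun i _ => ?_
    ext k l
    simp only [selectPort, Scheme.postMeasurement, traceSnd, traceFst, Matrix.mul_apply,
      Matrix.of_apply, Matrix.reindex_apply, Matrix.submatrix_apply, Matrix.kroneckerMap_apply,
      Matrix.smul_apply, smul_eq_mul, Finset.mul_sum]
    refine Finset.sum_congr rfl fun _ _ => Finset.sum_congr rfl fun _ _ =>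
      Finset.sum_congr rfl fun _ _ => ?_
    ring

/-- The entanglement fidelity `F(Λ) = F(Λ, id)` of a scheme with channel `Λ`. -/
def Scheme.fidelity {d N : ℕ} (P : Scheme d N) : ℝ :=
  entanglementFidelity P.channel LinearMap.id

/-- The diamond norm error `‖id - Λ‖_⋄` of a scheme with channel `Λ`. -/
def Scheme.diamondError {d N : ℕ} (P : Scheme d N) : ℝ :=
  diamondNorm (LinearMap.id - P.channel)

/-- The optimal entanglement fidelity `F_d^*(N)`, over all resource states and measurements. -/
def optimalFidelity (d N : ℕ) : ℝ := ⨆ P : Scheme d N, P.fidelity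

/-- The optimal diamond norm error `ε_d^*(N)`, over all resource states and measurements. -/
def optimalDiamondError (d N : ℕ) : ℝ := ⨅ P : Scheme d N, P.diamondError

end

end PortTeleport

open scoped Kronecker ComplexOrder MatrixOrder

namespace PortTeleport

/-! ### Trace norm and positivity -/

section Matrix

variable {ι κ : Type*} [Fintype ι] [Fintype κ]

/-! Feed half of a maximally entangled state into the scheme, and let `σ_i` be the unnormalized
state of reference and ports after outcome `i`. Write `φ_i` for the projection onto the maximally
entangled state of the reference and port `i`. The entanglement fidelity is `F = ∑ᵢ tr (φ_i σ_i)`.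
The POVM sums to one, so `∑ᵢ σ_i` is the maximally mixed reference tensored with Bob's reduced
resource, and hence `tr (φ_j ∑ᵢ σ_i) = d⁻²` for every `j` (`Scheme.isPortEnsemble`). Keeping only `i
= j` gives `F ≤ N / d²`, which settles few ports.

For many ports the obstruction is monogamy: `φ_i φ_j φ_i = d⁻² φ_i` for `i ≠ j`. A `σ_i` supported
near `φ_i` therefore has overlap about `d⁻² tr σ_i` with each other `φ_j`. Summed over pairs this
would be about `(N - 1) / d²`, whereas only `N / d² - F` is available; were every `σ_i` exactly on
`φ_i`, `F = 1` would force `d = 1`. `posSemidef_projection_combination` makes this quantitative with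
a free parameter `t`, and `IsPortEnsemble.overlap_le` chooses `t`.

For the diamond norm, the maximally entangled input is a test state: the difference of the two
outputs is traceless, and pairing it with the maximally entangled projection gives an error of at
least `2 (1 - F)`. -/

theorem exists_eq_conjTranspose_mul_self [DecidableEq ι] {A : Matrix ι ι ℂ} (hA : A.PosSemidef) :
    ∃ C : Matrix ι ι ℂ, A = C.conjTranspose * C := by
  refine ⟨CFC.sqrt A, ?_⟩
  have h : (CFC.sqrt A).conjTranspose = CFC.sqrt A :=
    (Matrix.nonneg_iff_posSemidef.mp (CFC.sqrt_nonneg A)).isHermitian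
  rw [h, CFC.sqrt_mul_sqrt_self A hA.nonneg]

theorem trace_mul_nonneg [DecidableEq ι] {A B : Matrix ι ι ℂ} (hA : A.PosSemidef)
    (hB : B.PosSemidef) : 0 ≤ (A * B).trace := by
  obtain ⟨C, rfl⟩ := exists_eq_conjTranspose_mul_self hA
  rw [Matrix.mul_assoc, Matrix.trace_mul_comm]
  exact (hB.mul_mul_conjTranspose_same C).trace_nonneg

theorem trace_mul_re_nonneg [DecidableEq ι] {A B : Matrix ι ι ℂ} (hA : A.PosSemidef)
    (hB : B.PosSemidef) : 0 ≤ (A * B).trace.re :=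
  (Complex.le_def.mp (trace_mul_nonneg hA hB)).1

theorem trace_conjTranspose_mul_self (X : Matrix ι ι ℂ) :
    (X.conjTranspose * X).trace.re = ∑ p, ∑ q, ‖X p q‖ ^ 2 := by
  rw [Finset.sum_comm]
  simp only [Matrix.trace, Matrix.diag_apply, Matrix.mul_apply, Matrix.conjTranspose_apply,
    Complex.re_sum]
  refine Finset.sum_congr rfl fun p _ => Finset.sum_congr rfl fun q _ => ?_
  rw [Complex.star_def, ← Complex.normSq_eq_conj_mul_self, Complex.ofReal_re,
    Complex.normSq_eq_norm_sq]

theorem posSemidef_of_isHermitian_of_isIdempotent {P : Matrix ι ι ℂ} (h : P.IsHermitian)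
    (hP : P * P = P) : P.PosSemidef := by
  have := Matrix.posSemidef_conjTranspose_mul_self P
  rwa [h.eq, hP] at this

variable [DecidableEq ι] [DecidableEq κ]

theorem traceNorm_eq_trace_abs (X : Matrix ι ι ℂ) : traceNorm X = (CFC.abs X).trace.re := rfl

theorem posSemidef_abs (X : Matrix ι ι ℂ) : (CFC.abs X).PosSemidef :=
  Matrix.nonneg_iff_posSemidef.mp (CFC.abs_nonneg X)

theorem traceNorm_nonneg (X : Matrix ι ι ℂ) : 0 ≤ traceNorm X :=
  (Complex.le_def.mp (posSemidef_abs X).trace_nonneg).1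

theorem traceNorm_of_posSemidef {X : Matrix ι ι ℂ} (hX : X.PosSemidef) :
    traceNorm X = X.trace.re := by
  rw [traceNorm_eq_trace_abs, CFC.abs_of_nonneg X hX.nonneg]

theorem trace_abs_mul_abs (X : Matrix ι ι ℂ) :
    ((CFC.abs X).conjTranspose * CFC.abs X).trace.re = ∑ p, ∑ q, ‖X p q‖ ^ 2 := by
  rw [(posSemidef_abs X).isHermitian.eq, CFC.abs_mul_abs, Matrix.star_eq_conjTranspose,
    trace_conjTranspose_mul_self]

/-- Writing `A` as a Gram matrix, this is Cauchy–Schwarz for each pair of columns. -/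
theorem sum_norm_sq_le_trace_sq {A : Matrix ι ι ℂ} (hA : A.PosSemidef) :
    ∑ p, ∑ q, ‖A p q‖ ^ 2 ≤ A.trace.re ^ 2 := by
  obtain ⟨C, rfl⟩ := exists_eq_conjTranspose_mul_self hA
  have hC : ∑ k, ∑ p, ‖C k p‖ ^ 2 = ∑ p, ∑ k, ‖C k p‖ ^ 2 := Finset.sum_comm
  rw [trace_conjTranspose_mul_self, hC, sq, Finset.sum_mul_sum]
  refine Finset.sum_le_sum fun p _ => Finset.sum_le_sum fun q _ => ?_
  have h : ‖(C.conjTranspose * C) p q‖ ≤ ∑ k, ‖C k p‖ * ‖C k q‖ := by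
    rw [Matrix.mul_apply]
    refine (norm_sum_le _ _).trans_eq (Finset.sum_congr rfl fun k _ => ?_)
    simp
  exact (pow_le_pow_left₀ (norm_nonneg _) h 2).trans (Finset.sum_mul_sq_le_sq_mul_sq _ _ _)

theorem norm_apply_le_traceNorm (X : Matrix ι ι ℂ) (p q : ι) : ‖X p q‖ ≤ traceNorm X := by
  refine le_of_sq_le_sq ?_ (traceNorm_nonneg X)
  calc ‖X p q‖ ^ 2 ≤ ∑ q, ‖X p q‖ ^ 2 :=
        Finset.single_le_sum (f := fun q => ‖X p q‖ ^ 2) (fun _ _ => by positivity)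
          (Finset.mem_univ q)
    _ ≤ ∑ p, ∑ q, ‖X p q‖ ^ 2 :=
        Finset.single_le_sum (f := fun p => ∑ q, ‖X p q‖ ^ 2) (fun _ _ => by positivity)
          (Finset.mem_univ p)
    _ = ∑ p, ∑ q, ‖CFC.abs X p q‖ ^ 2 := by
        rw [← trace_abs_mul_abs, trace_conjTranspose_mul_self]
    _ ≤ traceNorm X ^ 2 := sum_norm_sq_le_trace_sq (posSemidef_abs X)

theorem traceNorm_sq_le (X : Matrix ι ι ℂ) :
    traceNorm X ^ 2 ≤ Fintype.card ι * ∑ p, ∑ q, ‖X p q‖ ^ 2 := by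
  rw [← trace_abs_mul_abs, trace_conjTranspose_mul_self, traceNorm_eq_trace_abs, Matrix.trace,
    Complex.re_sum]
  refine sq_sum_le_card_mul_sum_sq.trans ?_
  rw [Finset.card_univ]
  gcongr with p
  calc (CFC.abs X p p).re ^ 2 ≤ ‖CFC.abs X p p‖ ^ 2 :=
        sq_le_sq' (neg_le_of_abs_le (Complex.abs_re_le_norm _))
          (Complex.re_le_norm _)
    _ ≤ ∑ q, ‖CFC.abs X p q‖ ^ 2 :=
        Finset.single_le_sum (f := fun q => ‖CFC.abs X p q‖ ^ 2) (fun _ _ => by positivity)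
          (Finset.mem_univ p)

/-- A real `sSup` is an upper bound only for a bounded set, so this is what lets a single input
bound the diamond norm from below. The bound is crude: entries of `X` are at most one, and the trace
norm is controlled by the Frobenius norm. -/
theorem bddAbove_traceNorm_map (T : Matrix ι ι ℂ →ₗ[ℂ] Matrix κ κ ℂ) :
    BddAbove {r : ℝ | ∃ X : Matrix ι ι ℂ, traceNorm X ≤ 1 ∧ r = traceNorm (T X)} := by
  let K : κ → κ → ℝ := fun r s => ∑ p, ∑ q, ‖T (Matrix.single p q 1) r s‖
  refine ⟨√(Fintype.card κ * ∑ r, ∑ s, K r s ^ 2), ?_⟩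
  rintro _ ⟨X, hX, rfl⟩
  refine Real.le_sqrt_of_sq_le ((traceNorm_sq_le _).trans ?_)
  gcongr with r _ s _
  have hT : T X r s = ∑ p, ∑ q, X p q * T (Matrix.single p q 1) r s := by
    conv_lhs => rw [Matrix.matrix_eq_sum_single X]
    simp only [map_sum, Matrix.sum_apply]
    refine Finset.sum_congr rfl fun p _ => Finset.sum_congr rfl fun q _ => ?_
    rw [← mul_one (X p q), ← smul_eq_mul, ← Matrix.smul_single, map_smul, Matrix.smul_apply]
    simp
  rw [hT]
  refine (norm_sum_le _ _).trans (Finset.sum_le_sum fun p _ => ?_)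
  refine (norm_sum_le _ _).trans (Finset.sum_le_sum fun q _ => ?_)
  rw [norm_mul]
  exact mul_le_of_le_one_left (norm_nonneg _) ((norm_apply_le_traceNorm X p q).trans hX)

/-- Pair `|X| - X ≥ 0` with `P` and `|X| + X ≥ 0` with `1 - P`, then add; tracelessness removes the
remaining term. -/
theorem two_mul_trace_mul_le_traceNorm {X P : Matrix ι ι ℂ} (hX : X.IsHermitian)
    (htr : X.trace = 0) (hP : P.PosSemidef) (hQ : (1 - P).PosSemidef) :
    2 * (P * X).trace.re ≤ traceNorm X := by
  have hsa : IsSelfAdjoint X := hX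
  have h1 : (CFC.abs X - X).PosSemidef := by
    rw [CFC.abs_sub_self X hsa, ← Matrix.nonneg_iff_posSemidef]
    exact smul_nonneg (by norm_num) (CFC.negPart_nonneg X)
  have h2 : (CFC.abs X + X).PosSemidef := by
    rw [CFC.abs_add_self X hsa, ← Matrix.nonneg_iff_posSemidef]
    exact smul_nonneg (by norm_num) (CFC.posPart_nonneg X)
  have e1 := trace_mul_re_nonneg hP h1
  have e2 := trace_mul_re_nonneg hQ h2
  simp only [Matrix.mul_sub, Matrix.mul_add, Matrix.sub_mul, Matrix.one_mul, Matrix.trace_sub,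
    Matrix.trace_add, Complex.sub_re, Complex.add_re, htr, Complex.zero_re] at e1 e2
  rw [traceNorm_eq_trace_abs]
  linarith

theorem posSemidef_one_sub {P : Matrix ι ι ℂ} (h : P.IsHermitian)
    (hP : P * P = P) : (1 - P).PosSemidef := by
  refine posSemidef_of_isHermitian_of_isIdempotent (Matrix.isHermitian_one.sub h) ?_
  simp [Matrix.mul_sub, Matrix.sub_mul, hP]

/-- If `P φ P = δ⁻² P` for projections `P` and `φ`, then the off-diagonal part of
`δ φ - δ⁻¹` with respect to `P` can be absorbed into multiples of `1 - P` and `P`. -/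
theorem posSemidef_projection_combination {P φ : Matrix ι ι ℂ} (hP : P.IsHermitian)
    (hP2 : P * P = P) (hφ : φ.IsHermitian) (hφ2 : φ * φ = φ) {δ t : ℝ} (hδ : 0 < δ) (ht : 0 < t)
    (hPφ : P * φ * P = ((δ : ℂ) ^ 2)⁻¹ • P) :
    (((δ : ℂ) • φ - (δ : ℂ)⁻¹ • (1 : Matrix ι ι ℂ)) + ((t : ℂ) + (δ : ℂ)⁻¹) • (1 - P) +
      ((t : ℂ)⁻¹ * (1 - ((δ : ℂ) ^ 2)⁻¹)) • P).PosSemidef := by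
  set D : Matrix ι ι ℂ := (δ : ℂ) • φ - (δ : ℂ)⁻¹ • (1 : Matrix ι ι ℂ) with hD
  set Y : Matrix ι ι ℂ := (t : ℂ) • (1 - P) + D * P with hY
  have hδ' : (δ : ℂ) ≠ 0 := by exact_mod_cast hδ.ne'
  have ht' : (t : ℂ) ≠ 0 := by exact_mod_cast ht.ne'
  have hDH : D.conjTranspose = D := by simp [hD, hφ.eq]
  have hYH : Y.conjTranspose = (t : ℂ) • (1 - P) + P * D := by simp [hY, hDH, hP.eq]
  have hZH : (φ * (1 - P)).conjTranspose = (1 - P) * φ := by simp [hφ.eq, hP.eq]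
  -- The hypothesis gives `P D P = 0` and `P D² P = (1 - δ⁻²) P`. So `t⁻¹ Y† Y` supplies the
  -- off-diagonal blocks of `D` at the cost of `t (1 - P)` and `t⁻¹ (1 - δ⁻²) P`; the block `(1 - P)
  -- D (1 - P)` is `δ (1 - P) φ (1 - P)` minus `δ⁻¹ (1 - P)`.
  have key : D + ((t : ℂ) + (δ : ℂ)⁻¹) • (1 - P) + ((t : ℂ)⁻¹ * (1 - ((δ : ℂ) ^ 2)⁻¹)) • P
      = (t : ℂ)⁻¹ • (Y.conjTranspose * Y)
        + (δ : ℂ) • ((φ * (1 - P)).conjTranspose * (φ * (1 - P))) := by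
    have e1 : P * (φ * P) = ((δ : ℂ) ^ 2)⁻¹ • P := by rw [← Matrix.mul_assoc, hPφ]
    have e2 : φ * (φ * P) = φ * P := by rw [← Matrix.mul_assoc, hφ2]
    rw [hYH, hZH, hY, hD]
    simp only [Matrix.mul_add, Matrix.add_mul, Matrix.mul_sub, Matrix.sub_mul, Matrix.smul_mul,
      Matrix.mul_smul, Matrix.mul_one, Matrix.one_mul, Matrix.mul_assoc, hP2, hφ2, e1, e2,
      smul_sub, smul_add, smul_smul]
    match_scalars <;> field_simp <;> ring
  rw [key]
  refine (Matrix.PosSemidef.smul (Matrix.posSemidef_conjTranspose_mul_self _) ?_).add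
    (Matrix.PosSemidef.smul (Matrix.posSemidef_conjTranspose_mul_self _) ?_)
  · rw [← Complex.ofReal_inv]; exact_mod_cast (inv_pos.mpr ht).le
  · exact_mod_cast hδ.le

end Matrix

end PortTeleport

/-! ### Maximally entangled projections and the overlap bounds -/

namespace PortTeleport

noncomputable section

variable {d N : ℕ}

/-- The projection onto the maximally entangled state of the reference and the port `B_i`. -/
def portProj (d : ℕ) {N : ℕ} (i : Fin N) :
    Matrix (Fin d × (Fin N → Fin d)) (Fin d × (Fin N → Fin d)) ℂ :=
  Matrix.of fun p q =>
    if p.2 i = p.1 ∧ q.2 = Function.update p.2 i q.1 then (d : ℂ)⁻¹ else 0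

theorem portProj_isHermitian (i : Fin N) : (portProj d i).IsHermitian := by
  ext ⟨a, b⟩ ⟨a', b'⟩
  have h : ∀ {a a' : Fin d} {b b' : Fin N → Fin d}, b i = a ∧ b' = Function.update b i a' →
      b' i = a' ∧ b = Function.update b' i a := by
    rintro a a' b _ ⟨rfl, rfl⟩
    simp
  simp only [portProj, Matrix.conjTranspose_apply, Matrix.of_apply]
  split_ifs with h1 h2 h2
  · simp
  · exact absurd (h h1) h2
  · exact absurd (h h2) h1
  · simp

theorem portProj_mul_apply (i : Fin N) {κ : Type*}
    (M : Matrix (Fin d × (Fin N → Fin d)) κ ℂ) (p : Fin d × (Fin N → Fin d)) (q : κ) :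
    (portProj d i * M) p q =
      if p.2 i = p.1 then (d : ℂ)⁻¹ * ∑ a, M (a, Function.update p.2 i a) q else 0 := by
  rw [Matrix.mul_apply, Fintype.sum_prod_type]
  split_ifs with h
  · simp [portProj, h, Finset.mul_sum, ite_mul]
  · simp [portProj, h]

theorem portProj_mul_self (hd : 1 ≤ d) (i : Fin N) :
    portProj d i * portProj d i = portProj d i := by
  have hd' : (d : ℂ) ≠ 0 := by exact_mod_cast (by omega : d ≠ 0)
  ext p q
  rw [portProj_mul_apply]
  by_cases h : p.2 i = p.1
  · simp only [portProj, Matrix.of_apply, h, Function.update_self, Function.update_idem, true_and,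
      if_true, Finset.sum_const, Finset.card_univ, Fintype.card_fin, nsmul_eq_mul]
    split_ifs <;> field_simp
  · simp [portProj, h]

/-- Projecting onto `φ_i` leaves the reference maximally mixed and uncorrelated with `B_j`, and the
partial trace of `φ_j` over the reference is `d⁻¹` times the identity. -/
theorem portProj_mul_portProj_mul {i j : Fin N} (hij : i ≠ j) :
    portProj d i * portProj d j * portProj d i = ((d : ℂ) ^ 2)⁻¹ • portProj d i := by
  ext p q
  rw [Matrix.mul_assoc, portProj_mul_apply, Matrix.smul_apply]
  by_cases h : p.2 i = p.1
  · simp only [h, if_true, portProj_mul_apply, Function.update_of_ne hij.symm]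
    rw [Finset.sum_ite_eq Finset.univ (p.2 j)]
    simp only [Finset.mem_univ, if_true]
    rw [Finset.sum_eq_single (p.2 j)]
    · have : Function.update (Function.update p.2 i (p.2 j)) j (p.2 j)
          = Function.update p.2 i (p.2 j) := by
        rw [Function.update_eq_self_iff, Function.update_of_ne hij.symm]
      rw [this]
      simp only [portProj, Matrix.of_apply, Function.update_self, Function.update_idem, true_and,
        h, smul_eq_mul]
      ring
    · intro a _ ha
      simp [portProj, Function.update_of_ne hij, ha.symm]
    · simp
  · simp [portProj, h]

theorem portProj_posSemidef (hd : 1 ≤ d) (i : Fin N) : (portProj d i).PosSemidef :=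
  posSemidef_of_isHermitian_of_isIdempotent (portProj_isHermitian i) (portProj_mul_self hd i)

/-- The operators `σ_i` on the reference and the ports. Their overlaps with the maximally
entangled projections are limited by the form of their sum. -/
structure IsPortEnsemble (σ : Fin N → Matrix (Fin d × (Fin N → Fin d)) (Fin d × (Fin N → Fin d)) ℂ) :
    Prop where
  posSemidef : ∀ i, (σ i).PosSemidef
  trace_sum : (∑ i, σ i).trace = 1
  trace_portProj_mul_sum : ∀ j, (portProj d j * ∑ i, σ i).trace = ((d : ℂ) ^ 2)⁻¹

/-- The total overlap `∑ᵢ tr (φᵢ σᵢ)`. -/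
def overlap (σ : Fin N → Matrix (Fin d × (Fin N → Fin d)) (Fin d × (Fin N → Fin d)) ℂ) : ℝ :=
  ∑ i, (portProj d i * σ i).trace.re

namespace IsPortEnsemble

variable {σ : Fin N → Matrix (Fin d × (Fin N → Fin d)) (Fin d × (Fin N → Fin d)) ℂ}

theorem sum_trace_re (h : IsPortEnsemble σ) : ∑ i, (σ i).trace.re = 1 := by
  rw [← Complex.re_sum, ← Matrix.trace_sum, h.trace_sum, Complex.one_re]

theorem sum_trace_portProj_mul_re (h : IsPortEnsemble σ) (j : Fin N) :
    ∑ i, (portProj d j * σ i).trace.re = ((d : ℝ) ^ 2)⁻¹ := by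
  rw [← Complex.re_sum, ← Matrix.trace_sum, ← Matrix.mul_sum, h.trace_portProj_mul_sum,
    show ((d : ℂ) ^ 2)⁻¹ = ((((d : ℝ) ^ 2)⁻¹ : ℝ) : ℂ) by push_cast; rfl, Complex.ofReal_re]

theorem overlap_nonneg (h : IsPortEnsemble σ) (hd : 1 ≤ d) : 0 ≤ overlap σ :=
  Finset.sum_nonneg fun i _ => trace_mul_re_nonneg (portProj_posSemidef hd i) (h.posSemidef i)

theorem overlap_le_one (h : IsPortEnsemble σ) (hd : 1 ≤ d) : overlap σ ≤ 1 := by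
  rw [← h.sum_trace_re]
  refine Finset.sum_le_sum fun i _ => ?_
  have := trace_mul_re_nonneg
    (posSemidef_one_sub (portProj_isHermitian i) (portProj_mul_self hd i)) (h.posSemidef i)
  simp only [Matrix.sub_mul, Matrix.one_mul, Matrix.trace_sub, Complex.sub_re] at this
  linarith

theorem overlap_le_div (h : IsPortEnsemble σ) (hd : 1 ≤ d) :
    overlap σ ≤ N / (d : ℝ) ^ 2 := by
  calc overlap σ ≤ ∑ _i : Fin N, ((d : ℝ) ^ 2)⁻¹ := by
        refine Finset.sum_le_sum fun i _ => ?_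
        rw [← h.sum_trace_portProj_mul_re i]
        exact Finset.single_le_sum (f := fun k => (portProj d i * σ k).trace.re)
          (fun k _ => trace_mul_re_nonneg (portProj_posSemidef hd i) (h.posSemidef k))
          (Finset.mem_univ i)
    _ = N / (d : ℝ) ^ 2 := by simp [div_eq_mul_inv]

theorem combination_nonneg (h : IsPortEnsemble σ) (hd : 1 ≤ d) {t : ℝ} (ht : 0 < t)
    {i j : Fin N} (hij : i ≠ j) :
    0 ≤ d * (portProj d j * σ i).trace.re - (d : ℝ)⁻¹ * (σ i).trace.re
      + (t + (d : ℝ)⁻¹) * ((σ i).trace.re - (portProj d i * σ i).trace.re)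
      + t⁻¹ * (1 - ((d : ℝ) ^ 2)⁻¹) * (portProj d i * σ i).trace.re := by
  have hd0 : (0 : ℝ) < d := by exact_mod_cast hd
  have := trace_mul_re_nonneg (posSemidef_projection_combination
    (portProj_isHermitian i) (portProj_mul_self hd i) (portProj_isHermitian j)
    (portProj_mul_self hd j) hd0 ht (by simpa using portProj_mul_portProj_mul hij))
    (h.posSemidef i)
  have e1 : ((t : ℂ) + ((d : ℝ) : ℂ)⁻¹) = ((t + (d : ℝ)⁻¹ : ℝ) : ℂ) := by push_cast; rfl
  have e2 : ((t : ℂ)⁻¹ * (1 - (((d : ℝ) : ℂ) ^ 2)⁻¹))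
      = ((t⁻¹ * (1 - ((d : ℝ) ^ 2)⁻¹) : ℝ) : ℂ) := by push_cast; rfl
  rw [e1, e2, ← Complex.ofReal_inv] at this
  simpa only [Matrix.add_mul, Matrix.sub_mul, Matrix.smul_mul, Matrix.one_mul, Matrix.trace_add,
    Matrix.trace_sub, Matrix.trace_smul, smul_eq_mul, Complex.add_re, Complex.sub_re,
    Complex.re_ofReal_mul] using this

theorem sum_combination_nonneg (h : IsPortEnsemble σ) (hd : 1 ≤ d) {t : ℝ} (ht : 0 < t) :
    0 ≤ (d : ℝ)⁻¹ - d * overlap σ + (N - 1) * ((t + (d : ℝ)⁻¹) * (1 - overlap σ)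
      + t⁻¹ * (1 - ((d : ℝ) ^ 2)⁻¹) * overlap σ) := by
  have hd0 : (0 : ℝ) < d := by exact_mod_cast hd
  set A : ℝ := t⁻¹ * (1 - ((d : ℝ) ^ 2)⁻¹) with hA
  -- Sum over ordered pairs `i ≠ j`; the excluded diagonal is what produces `-d * overlap σ`.
  have hsum : 0 ≤ ∑ i, ∑ j ∈ Finset.univ.erase i,
      (d * (portProj d j * σ i).trace.re - (d : ℝ)⁻¹ * (σ i).trace.re
      + (t + (d : ℝ)⁻¹) * ((σ i).trace.re - (portProj d i * σ i).trace.re)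
      + A * (portProj d i * σ i).trace.re) :=
    Finset.sum_nonneg fun i _ => Finset.sum_nonneg fun j hj =>
      h.combination_nonneg hd ht (Finset.ne_of_mem_erase hj).symm
  have hcross : ∑ i, ∑ j, (portProj d j * σ i).trace.re = N * ((d : ℝ) ^ 2)⁻¹ := by
    rw [Finset.sum_comm]
    simp [h.sum_trace_portProj_mul_re]
  have htr := h.sum_trace_re
  have heq : ∑ i, ∑ j ∈ Finset.univ.erase i,
      (d * (portProj d j * σ i).trace.re - (d : ℝ)⁻¹ * (σ i).trace.re
      + (t + (d : ℝ)⁻¹) * ((σ i).trace.re - (portProj d i * σ i).trace.re)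
      + A * (portProj d i * σ i).trace.re)
      = d * (∑ i, ∑ j, (portProj d j * σ i).trace.re - ∑ i, (portProj d i * σ i).trace.re)
        - (N - 1) * ((d : ℝ)⁻¹ * ∑ i, (σ i).trace.re)
        + (N - 1) * ((t + (d : ℝ)⁻¹) * (∑ i, (σ i).trace.re - ∑ i, (portProj d i * σ i).trace.re)
          + A * ∑ i, (portProj d i * σ i).trace.re) := by
    simp only [Finset.mul_sum, ← Finset.sum_sub_distrib, ← Finset.sum_add_distrib]
    refine Finset.sum_congr rfl fun i _ => ?_
    rw [← Finset.add_sum_erase Finset.univ (fun j => (portProj d j * σ i).trace.re)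
      (Finset.mem_univ i)]
    simp only [Finset.sum_add_distrib, Finset.sum_sub_distrib, ← Finset.mul_sum,
      Finset.sum_const, nsmul_eq_mul]
    rw [Finset.card_erase_of_mem (Finset.mem_univ i), Finset.card_univ, Fintype.card_fin,
      Nat.cast_sub (by have := i.pos; omega)]
    push_cast
    ring
  rw [heq, hcross, htr, ← overlap] at hsum
  convert hsum using 1
  field_simp
  ring

theorem overlap_le (h : IsPortEnsemble σ) (hd : 1 ≤ d) (hN : 1 ≤ N)
    (hdN : (d : ℝ) ^ 2 / 2 < N) :
    overlap σ ≤ 1 - ((d : ℝ) ^ 2 - 1) / (16 * (N : ℝ) ^ 2) := by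
  have hd1 : (1 : ℝ) ≤ d := by exact_mod_cast hd
  have hN1 : (1 : ℝ) ≤ N := by exact_mod_cast hN
  have hF0 := h.overlap_nonneg hd
  have hF1 := h.overlap_le_one hd
  -- With `t = 2N / d` the `t⁻¹` term is at most half of `(d² - 1) / d`, the deficit at `F = 1`, so
  -- the other half must be paid for by terms in `1 - F`.
  have key := h.sum_combination_nonneg hd (t := 2 * N / d) (by positivity)
  set F := overlap σ
  have hdN' : (d : ℝ) ≤ 2 * N := by nlinarith
  have key2 : 0 ≤ 2 * N * (1 - d ^ 2 * F) + (N - 1) * (2 * N * (2 * N + 1) * (1 - F)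
      + (d ^ 2 - 1) * F) := by
    have : 2 * N * (1 - d ^ 2 * F) + (N - 1) * (2 * N * (2 * N + 1) * (1 - F) + (d ^ 2 - 1) * F)
      = 2 * N * d * ((d : ℝ)⁻¹ - d * F + (N - 1) * ((2 * N / d + (d : ℝ)⁻¹) * (1 - F)
      + (2 * N / d : ℝ)⁻¹ * (1 - ((d : ℝ) ^ 2)⁻¹) * F)) := by
      field_simp
    rw [this]
    positivity
  have key3 : (d : ℝ) ^ 2 - 1 ≤ 2 * (d ^ 2 + 2 * N ^ 2) * (1 - F) := by
    have h1 : ((N : ℝ) - 1) * ((d ^ 2 - 1) * F) ≤ N * (d ^ 2 - 1) := by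
      have : (0 : ℝ) ≤ d ^ 2 - 1 := by nlinarith
      calc ((N : ℝ) - 1) * ((d ^ 2 - 1) * F) ≤ N * ((d ^ 2 - 1) * 1) := by gcongr; linarith
        _ = _ := by ring
    have h2 : ((N : ℝ) - 1) * (2 * N * (2 * N + 1) * (1 - F)) ≤ N * (4 * N ^ 2 * (1 - F)) := by
      have : ((N : ℝ) - 1) * (2 * N + 1) ≤ 2 * N ^ 2 := by nlinarith
      have hF : 0 ≤ 2 * N * (1 - F) := by have : 0 ≤ 1 - F := by linarith
                                          positivity
      nlinarith [mul_le_mul_of_nonneg_right this hF]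
    refine le_of_mul_le_mul_left ?_ (by linarith : (0 : ℝ) < N)
    nlinarith
  -- Here `d² < 2N ≤ 2N²`, so the coefficient is at most `8 N²`, with a factor two to spare.
  have key4 : (d : ℝ) ^ 2 - 1 ≤ 16 * N ^ 2 * (1 - F) := by
    refine key3.trans (mul_le_mul_of_nonneg_right ?_ (by linarith))
    nlinarith
  have : ((d : ℝ) ^ 2 - 1) / (16 * (N : ℝ) ^ 2) ≤ 1 - F := by
    rw [div_le_iff₀ (by positivity)]
    linarith
  linarith

end IsPortEnsemble

end

end PortTeleport

/-! ### The maximally entangled state and the test input -/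

namespace PortTeleport

noncomputable section

variable {d N : ℕ}

theorem trace_portProj_mul (i : Fin N)
    (M : Matrix (Fin d × (Fin N → Fin d)) (Fin d × (Fin N → Fin d)) ℂ) :
    (portProj d i * M).trace
      = (d : ℂ)⁻¹ * ∑ b : Fin N → Fin d, ∑ a, M (a, Function.update b i a) (b i, b) := by
  simp only [Matrix.trace, Matrix.diag_apply, portProj_mul_apply]
  rw [Fintype.sum_prod_type_right, Finset.mul_sum]
  simp

theorem phiState_apply (p q : Fin d × Fin d) :
    phiState d p q = if p.1 = p.2 ∧ q.1 = q.2 then (d : ℂ)⁻¹ else 0 := by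
  have h : ((1 / √(d : ℝ) : ℝ) : ℂ) * ((1 / √(d : ℝ) : ℝ) : ℂ) = (d : ℂ)⁻¹ := by
    rw [← Complex.ofReal_mul, ← mul_div_mul_comm, Real.mul_self_sqrt (by positivity)]
    simp
  simp only [phiState, phiVec, Matrix.vecMulVec_apply, Pi.star_apply]
  by_cases h1 : p.1 = p.2 <;> by_cases h2 : q.1 = q.2 <;> simp only [h1, h2, if_true, if_false,
    and_self, and_true, and_false, star_zero, zero_mul, mul_zero, Complex.star_def,
    Complex.conj_ofReal, h]

theorem phiState_posSemidef : (phiState d).PosSemidef :=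
  Matrix.posSemidef_vecMulVec_self_star _

theorem trace_phiState (hd : 1 ≤ d) : (phiState d).trace = 1 := by
  have hd' : (d : ℂ) ≠ 0 := by exact_mod_cast (by omega : d ≠ 0)
  simp [Matrix.trace, phiState_apply, Fintype.sum_prod_type, hd']

theorem phiState_mul_mul (M : Matrix (Fin d × Fin d) (Fin d × Fin d) ℂ) :
    phiState d * M * phiState d = (phiState d * M).trace • phiState d := by
  simp only [phiState, Matrix.vecMulVec_mul, Matrix.trace_vecMulVec]
  rw [Matrix.vecMul_vecMulVec, Matrix.vecMulVec_smul, dotProduct_comm]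

theorem phiState_mul_self (hd : 1 ≤ d) : phiState d * phiState d = phiState d := by
  simpa [trace_phiState hd] using phiState_mul_mul (1 : Matrix (Fin d × Fin d) (Fin d × Fin d) ℂ)

theorem trace_phiState_mul (M : Matrix (Fin d × Fin d) (Fin d × Fin d) ℂ) :
    (phiState d * M).trace = (d : ℂ)⁻¹ * ∑ a, ∑ a', M (a', a') (a, a) := by
  simp only [Matrix.trace, Matrix.diag_apply, Matrix.mul_apply, phiState_apply,
    Fintype.sum_prod_type, Finset.mul_sum]
  refine Finset.sum_congr rfl fun a _ => ?_
  rw [Finset.sum_eq_single a]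
  · simp
  · intro b _ hb
    simp [hb.symm]
  · simp

/-- The fidelity with the maximally entangled state is an overlap. -/
theorem fidelity_phiState (hd : 1 ≤ d) {M : Matrix (Fin d × Fin d) (Fin d × Fin d) ℂ}
    (hM : M.PosSemidef) : fidelity M (phiState d) = (phiState d * M).trace.re := by
  have hphi : CFC.sqrt (phiState d) = phiState d :=
    CFC.sqrt_unique (phiState_mul_self hd) phiState_posSemidef.nonneg
  have hs : (CFC.sqrt M).conjTranspose = CFC.sqrt M :=
    (Matrix.nonneg_iff_posSemidef.mp (CFC.sqrt_nonneg M)).isHermitian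
  have hF := trace_mul_nonneg (phiState_posSemidef (d := d)) hM
  set F := (phiState d * M).trace with hFdef
  have hFr : F = (F.re : ℂ) := Complex.ext rfl (Complex.le_def.mp hF).2.symm
  have hF0 : 0 ≤ F.re := (Complex.le_def.mp hF).1
  -- Since `φ` has rank one, `φ M φ` is a multiple of `φ`, and its square root is explicit.
  have hsq : (CFC.sqrt M * phiState d).conjTranspose * (CFC.sqrt M * phiState d)
      = F • phiState d := by
    rw [Matrix.conjTranspose_mul, hs, phiState_posSemidef.isHermitian.eq, ← Matrix.mul_assoc,
      Matrix.mul_assoc (phiState d), CFC.sqrt_mul_sqrt_self M hM.nonneg, phiState_mul_mul]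
  have hsqrt : CFC.sqrt (F • phiState d) = ((√F.re : ℝ) : ℂ) • phiState d := by
    refine CFC.sqrt_unique ?_ (Matrix.PosSemidef.nonneg (phiState_posSemidef.smul ?_))
    · rw [Matrix.smul_mul, Matrix.mul_smul, phiState_mul_self hd, smul_smul, ← Complex.ofReal_mul,
        Real.mul_self_sqrt hF0, ← hFr]
    · exact_mod_cast Real.sqrt_nonneg _
  rw [fidelity, traceNorm, hphi, hsq, hsqrt, Matrix.trace_smul, trace_phiState hd, smul_eq_mul,
    mul_one, Complex.ofReal_re, Real.sq_sqrt hF0]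

/-- The map `id ⊗ Λ` as a linear map. -/
def idTensorLinear {ι ι' : Type*} (κ : Type*) (Λ : Matrix ι ι ℂ →ₗ[ℂ] Matrix ι' ι' ℂ) :
    Matrix (κ × ι) (κ × ι) ℂ →ₗ[ℂ] Matrix (κ × ι') (κ × ι') ℂ where
  toFun := idTensor κ Λ
  map_add' X Y := by
    ext p q
    exact congrFun₂ (Λ.map_add (Matrix.of fun a b => X (p.1, a) (q.1, b))
      (Matrix.of fun a b => Y (p.1, a) (q.1, b))) p.2 q.2
  map_smul' c X := by
    ext p q
    exact congrFun₂ (Λ.map_smul c (Matrix.of fun a b => X (p.1, a) (q.1, b))) p.2 q.2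

theorem traceNorm_idTensor_le_diamondNorm {ι ι' : Type*} [Fintype ι] [DecidableEq ι] [Fintype ι']
    [DecidableEq ι'] (Λ : Matrix ι ι ℂ →ₗ[ℂ] Matrix ι' ι' ℂ) {X : Matrix (ι × ι) (ι × ι) ℂ}
    (hX : traceNorm X ≤ 1) : traceNorm (idTensor ι Λ X) ≤ diamondNorm Λ :=
  le_csSup (bddAbove_traceNorm_map (idTensorLinear ι Λ)) ⟨X, hX, rfl⟩

/-! ### The ensemble and Choi state of a scheme -/

namespace Scheme

variable (P : Scheme d N)

/-- The joint unnormalized state of the reference and the ports after outcome `i`, when half of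
a maximally entangled state is teleported. -/
def ensemble (i : Fin N) : Matrix (Fin d × (Fin N → Fin d)) (Fin d × (Fin N → Fin d)) ℂ :=
  Matrix.of fun p q => (d : ℂ)⁻¹ *
    ∑ m, ∑ m', P.povm i (q.1, m) (p.1, m') * P.resource (m', p.2) (m, q.2)

theorem ensemble_posSemidef (i : Fin N) : (P.ensemble i).PosSemidef := by
  obtain ⟨C, hC⟩ := exists_eq_conjTranspose_mul_self (P.isPOVM_povm.1 i)
  obtain ⟨K, hK⟩ := exists_eq_conjTranspose_mul_self P.isState_resource.1
  -- Factoring `E_i = C† C` and `ρ = K† K` exhibits the contraction over Alice's system as a Gram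
  -- matrix.
  let W : Matrix (Fin d × (Fin N → Fin d)) ((Fin d × Fin P.m) × (Fin P.m × (Fin N → Fin d))) ℂ :=
    Matrix.of fun p k => ∑ m', C k.1 (p.1, m') * star (K k.2 (m', p.2))
  have h : P.ensemble i = (d : ℂ)⁻¹ • (W * W.conjTranspose) := by
    ext p q
    simp only [ensemble, Matrix.of_apply, Matrix.smul_apply, smul_eq_mul, Matrix.mul_apply,
      Matrix.conjTranspose_apply, W, hC, hK, star_sum, star_mul', star_star,
      Finset.sum_mul_sum, Fintype.sum_prod_type (α₁ := Fin d × Fin P.m)]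
    congr 1
    calc _ = ∑ m, ∑ m', ∑ x, ∑ y, C x (p.1, m') * star (K y (m', p.2)) *
          (star (C x (q.1, m)) * K y (m, q.2)) := by
          refine Finset.sum_congr rfl fun m _ => Finset.sum_congr rfl fun m' _ =>
            Finset.sum_congr rfl fun x _ => Finset.sum_congr rfl fun y _ => ?_
          ring
      _ = ∑ m, ∑ x, ∑ m', ∑ y, C x (p.1, m') * star (K y (m', p.2)) *
          (star (C x (q.1, m)) * K y (m, q.2)) :=
          Finset.sum_congr rfl fun m _ => Finset.sum_comm
      _ = ∑ x, ∑ m, ∑ y, ∑ m', C x (p.1, m') * star (K y (m', p.2)) *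
          (star (C x (q.1, m)) * K y (m, q.2)) := by
          rw [Finset.sum_comm]
          exact Finset.sum_congr rfl fun x _ => Finset.sum_congr rfl fun m _ => Finset.sum_comm
      _ = ∑ x, ∑ y, ∑ m', ∑ m, C x (p.1, m') * star (K y (m', p.2)) *
          (star (C x (q.1, m)) * K y (m, q.2)) := by
          refine Finset.sum_congr rfl fun x _ => ?_
          rw [Finset.sum_comm]
          exact Finset.sum_congr rfl fun y _ => Finset.sum_comm
  rw [h]
  exact (Matrix.posSemidef_self_mul_conjTranspose W).smul (by positivity)

theorem sum_ensemble_apply (p q : Fin d × (Fin N → Fin d)) :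
    (∑ i, P.ensemble i) p q =
      if p.1 = q.1 then (d : ℂ)⁻¹ * ∑ m, P.resource (m, p.2) (m, q.2) else 0 := by
  have hE : ∀ x y, ∑ i, P.povm i x y = if x = y then 1 else 0 := fun x y => by
    rw [← Matrix.sum_apply, P.isPOVM_povm.2, Matrix.one_apply]
  simp only [ensemble, Matrix.sum_apply, Matrix.of_apply]
  rw [← Finset.mul_sum, Finset.sum_comm]
  simp_rw [Finset.sum_comm (s := Finset.univ (α := Fin N)), ← Finset.sum_mul, hE, Prod.mk.injEq]
  by_cases h : p.1 = q.1
  · simp [h]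
  · simp [h, Ne.symm h]

theorem sum_resource_diag : ∑ b, ∑ m, P.resource (m, b) (m, b) = 1 := by
  rw [← P.isState_resource.2, Matrix.trace, Fintype.sum_prod_type_right]
  rfl

theorem isPortEnsemble (hd : 1 ≤ d) : IsPortEnsemble P.ensemble where
  posSemidef := P.ensemble_posSemidef
  trace_sum := by
    have hd' : (d : ℂ) ≠ 0 := by exact_mod_cast (by omega : d ≠ 0)
    simp only [Matrix.trace, Matrix.diag_apply, sum_ensemble_apply, if_true,
      Fintype.sum_prod_type, ← Finset.mul_sum, P.sum_resource_diag]
    simp [hd']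
  trace_portProj_mul_sum j := by
    simp only [trace_portProj_mul, sum_ensemble_apply]
    simp only [Finset.sum_ite_eq', Finset.mem_univ, if_true, Function.update_eq_self,
      ← Finset.mul_sum, P.sum_resource_diag]
    ring

theorem postMeasurement_phiState (i : Fin N) (a a' : Fin d) (b b' : Fin N → Fin d) :
    P.postMeasurement i (Matrix.of fun x y => phiState d (a, x) (a', y)) b b'
      = P.ensemble i (a, b) (a', b') := by
  simp only [postMeasurement, traceFst, ensemble, Matrix.of_apply, Matrix.mul_apply,
    Matrix.kroneckerMap_apply, Matrix.reindex_apply, Matrix.submatrix_apply, Equiv.symm_symm,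
    Equiv.prodAssoc_apply, Matrix.one_apply, phiState_apply, Fintype.sum_prod_type, ite_and,
    ite_mul, mul_ite, mul_one, mul_zero, zero_mul, Finset.mul_sum]
  rw [Finset.sum_eq_single a']
  · refine Finset.sum_congr rfl fun m _ => ?_
    rw [Finset.sum_eq_single a]
    · refine Finset.sum_congr rfl fun m' _ => ?_
      simp only [if_true, Finset.sum_ite_eq, Finset.mem_univ]
      ring
    · intro x _ hx
      simp [hx.symm]
    · simp
  · intro x _ hx
    simp [hx.symm]
  · simp

/-- The Choi state of the channel. -/
def choi : Matrix (Fin d × Fin d) (Fin d × Fin d) ℂ := idTensor (Fin d) P.channel (phiState d)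

theorem choi_apply (p q : Fin d × Fin d) :
    P.choi p q = ∑ i, ∑ r, P.ensemble i (p.1, (Equiv.funSplitAt i (Fin d)).symm (p.2, r))
      (q.1, (Equiv.funSplitAt i (Fin d)).symm (q.2, r)) := by
  simp only [choi, idTensor, channel, LinearMap.coe_mk, AddHom.coe_mk, Matrix.of_apply,
    Matrix.sum_apply, selectPort, traceSnd, Matrix.reindex_apply, Matrix.submatrix_apply,
    postMeasurement_phiState]

theorem choi_posSemidef : P.choi.PosSemidef := by
  have h : P.choi = ∑ i, ∑ r, (P.ensemble i).submatrix
      (fun p : Fin d × Fin d => (p.1, (Equiv.funSplitAt i (Fin d)).symm (p.2, r)))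
      (fun p : Fin d × Fin d => (p.1, (Equiv.funSplitAt i (Fin d)).symm (p.2, r))) := by
    ext p q
    simp [choi_apply, Matrix.sum_apply]
  rw [h]
  exact Matrix.posSemidef_sum _ fun i _ => Matrix.posSemidef_sum _ fun r _ =>
    (P.ensemble_posSemidef i).submatrix _

theorem sum_sum_funSplitAt_symm (i : Fin N) (f : (Fin N → Fin d) → ℂ) :
    ∑ o, ∑ r, f ((Equiv.funSplitAt i (Fin d)).symm (o, r)) = ∑ b, f b := by
  rw [← Equiv.sum_comp (Equiv.funSplitAt i (Fin d)).symm, Fintype.sum_prod_type]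

theorem trace_choi (hd : 1 ≤ d) : P.choi.trace = 1 := by
  rw [← (P.isPortEnsemble hd).trace_sum, Matrix.trace_sum]
  simp only [Matrix.trace, Matrix.diag_apply, choi_apply]
  rw [Finset.sum_comm]
  refine Finset.sum_congr rfl fun i _ => ?_
  rw [Fintype.sum_prod_type, Fintype.sum_prod_type]
  exact Finset.sum_congr rfl fun a _ =>
    sum_sum_funSplitAt_symm i fun b => P.ensemble i (a, b) (a, b)

theorem update_funSplitAt_symm (i : Fin N) (o a : Fin d) (r : {j // j ≠ i} → Fin d) :
    Function.update ((Equiv.funSplitAt i (Fin d)).symm (o, r)) i a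
      = (Equiv.funSplitAt i (Fin d)).symm (a, r) := by
  ext j
  by_cases h : j = i
  · subst h; simp
  · simp [h]

theorem trace_phiState_mul_choi : (phiState d * P.choi).trace.re = overlap P.ensemble := by
  have h : (phiState d * P.choi).trace = ∑ i, (portProj d i * P.ensemble i).trace := by
    simp only [trace_phiState_mul, trace_portProj_mul, choi_apply, ← Finset.mul_sum]
    congr 1
    calc _ = ∑ i, ∑ a, ∑ a', ∑ r,
          P.ensemble i (a', (Equiv.funSplitAt i (Fin d)).symm (a', r))
            (a, (Equiv.funSplitAt i (Fin d)).symm (a, r)) := by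
          rw [Finset.sum_comm]
          simp_rw [Finset.sum_comm (s := Finset.univ (α := Fin d))
            (t := Finset.univ (α := Fin N))]
          exact Finset.sum_congr rfl fun i _ => Finset.sum_comm
      _ = _ := by
          refine Finset.sum_congr rfl fun i _ => ?_
          rw [← sum_sum_funSplitAt_symm i]
          refine Finset.sum_congr rfl fun a _ => ?_
          rw [Finset.sum_comm]
          refine Finset.sum_congr rfl fun r _ => Finset.sum_congr rfl fun a' _ => ?_
          rw [update_funSplitAt_symm]
          simp
  rw [h, Complex.re_sum, overlap]

theorem fidelity_eq_overlap (hd : 1 ≤ d) : P.fidelity = overlap P.ensemble := by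
  have hid : idTensor (Fin d) (LinearMap.id : Matrix (Fin d) (Fin d) ℂ →ₗ[ℂ] _) (phiState d)
      = phiState d := rfl
  rw [fidelity, entanglementFidelity, hid, ← choi, fidelity_phiState hd P.choi_posSemidef,
    trace_phiState_mul_choi]

theorem two_mul_one_sub_fidelity_le_diamondError (hd : 1 ≤ d) :
    2 * (1 - P.fidelity) ≤ P.diamondError := by
  have hphi := traceNorm_of_posSemidef (phiState_posSemidef (d := d))
  rw [trace_phiState hd, Complex.one_re] at hphi
  refine le_trans ?_ (traceNorm_idTensor_le_diamondNorm _ hphi.le)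
  have hsub : idTensor (Fin d) (LinearMap.id - P.channel) (phiState d)
      = phiState d - P.choi := rfl
  have htr : (phiState d - P.choi).trace = 0 := by
    rw [Matrix.trace_sub, trace_phiState hd, P.trace_choi hd, sub_self]
  have := two_mul_trace_mul_le_traceNorm
    (phiState_posSemidef.isHermitian.sub P.choi_posSemidef.isHermitian) htr
    (phiState_posSemidef (d := d))
    (posSemidef_one_sub phiState_posSemidef.isHermitian (phiState_mul_self hd))
  rw [hsub, P.fidelity_eq_overlap hd, ← P.trace_phiState_mul_choi]
  rwa [Matrix.mul_sub, phiState_mul_self hd, Matrix.trace_sub, trace_phiState hd,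
    Complex.sub_re, Complex.one_re] at this

theorem fidelity_le_sqrt_div (hd : 1 ≤ d) (hdN : (N : ℝ) ≤ (d : ℝ) ^ 2 / 2) :
    P.fidelity ≤ √(N : ℝ) / d := by
  have hd0 : (0 : ℝ) < d := by exact_mod_cast hd
  -- Only `N ≤ d²` is needed: `N / d²` is the square of `√N / d`, a number in `[0, 1]`.
  have hs : √(N : ℝ) ≤ d := Real.sqrt_le_iff.mpr ⟨hd0.le, by nlinarith⟩
  calc P.fidelity ≤ N / (d : ℝ) ^ 2 := by
        rw [P.fidelity_eq_overlap hd]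
        exact (P.isPortEnsemble hd).overlap_le_div hd
    _ = √(N : ℝ) / d * (√(N : ℝ) / d) := by
        rw [← mul_div_mul_comm, Real.mul_self_sqrt (by positivity), sq]
    _ ≤ √(N : ℝ) / d * 1 := by
        gcongr
        exact (div_le_one hd0).mpr hs
    _ = √(N : ℝ) / d := mul_one _

theorem fidelity_le_one_sub (hd : 1 ≤ d) (hN : 1 ≤ N) (hdN : (d : ℝ) ^ 2 / 2 < N) :
    P.fidelity ≤ 1 - ((d : ℝ) ^ 2 - 1) / (16 * (N : ℝ) ^ 2) := by
  rw [P.fidelity_eq_overlap hd]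
  exact (P.isPortEnsemble hd).overlap_le hd hN hdN

/-- Real infima and suprema over an empty family take the junk value zero, so some scheme is needed:
a pure product resource with uniformly random outcomes. -/
theorem nonempty (hd : 1 ≤ d) (hN : 1 ≤ N) : Nonempty (Scheme d N) := by
  let b : Fin 1 × (Fin N → Fin d) := (0, fun _ => ⟨0, hd⟩)
  have hN' : (N : ℂ) ≠ 0 := by exact_mod_cast (by omega : N ≠ 0)
  refine ⟨⟨1, Matrix.diagonal (Pi.single b 1), fun _ => (N : ℂ)⁻¹ • 1, ⟨?_, ?_⟩, ⟨fun _ => ?_, ?_⟩⟩⟩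
  · exact Matrix.PosSemidef.diagonal (Pi.single_nonneg.mpr zero_le_one)
  · simp [Matrix.trace_diagonal]
  · exact Matrix.PosSemidef.one.smul (by positivity)
  · simp [← Nat.cast_smul_eq_nsmul ℂ, smul_smul, hN']

end Scheme

end

end PortTeleport

theorem corollary6 (d N : ℕ) (hd : 1 ≤ d) (hN : 1 ≤ N) :
    ((N : ℝ) ≤ (d : ℝ) ^ 2 / 2 →
      (∀ P : PortTeleport.Scheme d N,
        P.fidelity ≤ √(N : ℝ) / d ∧ 2 * (1 - √(N : ℝ) / d) ≤ P.diamondError) ∧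
      PortTeleport.optimalFidelity d N ≤ √(N : ℝ) / d ∧
      2 * (1 - √(N : ℝ) / d) ≤ PortTeleport.optimalDiamondError d N) ∧
    ((d : ℝ) ^ 2 / 2 < (N : ℝ) →
      (∀ P : PortTeleport.Scheme d N,
        P.fidelity ≤ 1 - ((d : ℝ) ^ 2 - 1) / (16 * (N : ℝ) ^ 2) ∧
        2 * (((d : ℝ) ^ 2 - 1) / (16 * (N : ℝ) ^ 2)) ≤ P.diamondError) ∧
      PortTeleport.optimalFidelity d N ≤ 1 - ((d : ℝ) ^ 2 - 1) / (16 * (N : ℝ) ^ 2) ∧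
      2 * (((d : ℝ) ^ 2 - 1) / (16 * (N : ℝ) ^ 2)) ≤
        PortTeleport.optimalDiamondError d N) := by
  have := PortTeleport.Scheme.nonempty hd hN
  have hdiamond : ∀ (P : PortTeleport.Scheme d N) {c : ℝ}, P.fidelity ≤ 1 - c →
      2 * c ≤ P.diamondError := fun P c hc =>
    le_trans (by linarith) (P.two_mul_one_sub_fidelity_le_diamondError hd)
  refine ⟨fun h => ?_, fun h => ?_⟩
  · have hF := fun P : PortTeleport.Scheme d N => P.fidelity_le_sqrt_div hd h
    have hE := fun P : PortTeleport.Scheme d N =>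
      hdiamond P (c := 1 - √(N : ℝ) / d) (by linarith [hF P])
    exact ⟨fun P => ⟨hF P, hE P⟩, ciSup_le hF, le_ciInf hE⟩
  · have hF := fun P : PortTeleport.Scheme d N => P.fidelity_le_one_sub hd hN h
    have hE := fun P : PortTeleport.Scheme d N => hdiamond P (hF P)
    exact ⟨fun P => ⟨hF P, hE P⟩, ciSup_le hF, le_ciInf hE⟩
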